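/- Work in a universe of set theory with atoms (ZFA with choice) whose set of atoms is $A=\bigcup_{n<\omega}P_n$, where the $P_n=\{a_n,b_n\}$ are pairwise disjoint two-element sets. Let $G$ be the group of all permutations $\pi$ of $A$ with $\pi[P_n]=P_n$ for every $n$; each $\pi\in G$ acts on the universe by $\pi(x)=\{\pi(y): y\in x\}$ for sets $x$. For a finite $E\subseteq A$ let $\mathrm{fix}(E)=\{\pi\in G:\pi(a)=a\text{ for all }a\in E\}$; $E$ is a support of $x$ if $\pi(x)=x$ for all $\pi\in\mathrm{fix}(E)$. The Second Fraenkel Model $\mathcal N_2$ is the class of all hereditarily symmetric $x$, that is, those $x$ such that $x$, its members, the members of its members, and so on, all have finite supports. Let $[X]^{<\omega}$ denote the set of finite subsets of $X$. Hindman's theorem $\mathsf{HT}$ is the statement that for every infinite set $X$ and every $c:[X]^{<\omega}\to 2$ there is an infinite, pairwise disjoint family $Y\subseteq[X]^{<\omega}$ such that $c$ is constant on $\{\bigcup F: F\subseteq Y\text{ finite and nonempty}\}$. Theorem. (1) $\mathcal N_2\vDash\mathsf{HT}$. (2) Let $X\in\mathcal N_2$ be a set that, in $\mathcal N_2$, is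 infinite and not well-orderable, and let $E\subseteq A$ be any finite support of $X$. Then there are elements $x_k\in X$ $(k<\omega)$ such that the sequence $k\mapsto Y_k:=\{\pi(x_k):\pi\in\mathrm{fix}(E)\}$ belongs to $\mathcal N_2$ and is, in $\mathcal N_2$, an injective function from $\omega$ to $[X]^{<\omega}$. (The sequence $\langle x_k\rangle$ itself need not belong to $\mathcal N_2$.) -/

import Mathlib

universe u

/-! ## The language of set theory with atoms, and the notions used to state Hindman's theorem

Everything in this section is first-order over a structure `M` with a membership relation and a
predicate `IsAtom`: all quantifiers range over `M`, so that each notion is the relativization to `M`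
of the usual set-theoretic notion (in `ZFA`, where sets and atoms are told apart). -/

/-- A structure for the language of set theory with atoms. -/
class ZFAStructure (M : Type*) extends Membership M M where
  IsAtom : M → Prop

namespace ZFA

section Internal

variable {M : Type*} [ZFAStructure M]

/-- `x` is a set, that is, not an atom. -/
def IsSet (x : M) : Prop := ¬ ZFAStructure.IsAtom x

/-- `x` is a subset of `y` (in particular `x` is a set). -/
def IsSubset (x y : M) : Prop := IsSet x ∧ ∀ z : M, z ∈ x → z ∈ y

/-- `e = ∅`. -/
def IsEmptySet (e : M) : Prop := IsSet e ∧ ∀ z : M, ¬ z ∈ e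

/-- `z = {x, y}`. -/
def IsPairSet (z x y : M) : Prop := IsSet z ∧ ∀ w : M, w ∈ z ↔ w = x ∨ w = y

/-- `p = ⟨x, y⟩ = {{x}, {x, y}}`. -/
def IsOrdPair (p x y : M) : Prop :=
  ∃ s t : M, IsPairSet s x x ∧ IsPairSet t x y ∧ IsPairSet p s t

/-- `⟨x, y⟩ ∈ f`. -/
def Related (f x y : M) : Prop := ∃ p : M, IsOrdPair p x y ∧ p ∈ f

/-- `f` is a function from `X` to `Y` (as a set of ordered pairs). -/
def IsFunction (f X Y : M) : Prop :=
  IsSet f ∧ (∀ p : M, p ∈ f → ∃ x y : M, x ∈ X ∧ y ∈ Y ∧ IsOrdPair p x y) ∧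
    ∀ x : M, x ∈ X → ∃! y : M, Related f x y

/-- `f` is an injective function from `X` to `Y`. -/
def IsInjection (f X Y : M) : Prop :=
  IsFunction f X Y ∧ ∀ x x' y : M, Related f x y → Related f x' y → x = x'

/-- `f` is a bijection from `X` onto `Y`. -/
def IsBijection (f X Y : M) : Prop :=
  IsInjection f X Y ∧ ∀ y : M, y ∈ Y → ∃ x : M, x ∈ X ∧ Related f x y

/-- `s = n ∪ {n}`. -/
def IsSucc (s n : M) : Prop := IsSet s ∧ ∀ z : M, z ∈ s ↔ z ∈ n ∨ z = n

/-- `I` is a set that contains `∅` and is closed under `n ↦ n ∪ {n}`. -/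
def IsInductive (I : M) : Prop :=
  IsSet I ∧ (∃ e : M, IsEmptySet e ∧ e ∈ I) ∧
    ∀ n : M, n ∈ I → ∃ s : M, IsSucc s n ∧ s ∈ I

/-- `w = ω`, the least inductive set. -/
def IsOmega (w : M) : Prop := IsInductive w ∧ ∀ I : M, IsInductive I → IsSubset w I

/-- `X` is finite: some `n ∈ ω` is in bijection with `X`. -/
def IsFinite (X : M) : Prop :=
  ∃ w n f : M, IsOmega w ∧ n ∈ w ∧ IsBijection f n X

/-- `P = [X]^{<ω}`, the set of all finite subsets of `X`. -/
def IsFinPowerset (P X : M) : Prop :=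
  IsSet P ∧ ∀ y : M, y ∈ P ↔ IsSubset y X ∧ IsFinite y

/-- `U = ⋃ F`. -/
def IsUnion (U F : M) : Prop :=
  IsSet U ∧ ∀ z : M, z ∈ U ↔ ∃ y : M, y ∈ F ∧ z ∈ y

/-- `t = 2 = {0, 1} = {∅, {∅}}`. -/
def IsTwo (t : M) : Prop :=
  ∃ z o : M, IsEmptySet z ∧ IsSucc o z ∧ IsPairSet t z o

/-- The members of `Y` are pairwise disjoint. -/
def IsPairwiseDisjoint (Y : M) : Prop :=
  ∀ y y' : M, y ∈ Y → y' ∈ Y → y ≠ y' → ∀ z : M, ¬ (z ∈ y ∧ z ∈ y')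

/-- The colouring `c` is constant on the set `FU(Y)` of all unions `⋃ F`, where `F` ranges over the
nonempty finite subsets of `Y`. -/
def IsMonochromaticFU (c t Y : M) : Prop :=
  ∃ i : M, i ∈ t ∧ ∀ F : M, IsSubset F Y → IsFinite F → ¬ IsEmptySet F →
    ∃ U : M, IsUnion U F ∧ Related c U i

/-- `X` is well-orderable: some `R` is a strict linear order on `X` for which every nonempty subset
of `X` has a least element. -/
def IsWellOrderable (X : M) : Prop :=
  ∃ R : M, IsSet R ∧
    (∀ x : M, x ∈ X → ¬ Related R x x) ∧
    (∀ x y z : M, x ∈ X → y ∈ X → z ∈ X → Related R x y → Related R y z → Related R x z) ∧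
    (∀ x y : M, x ∈ X → y ∈ X → Related R x y ∨ x = y ∨ Related R y x) ∧
    ∀ S : M, IsSubset S X → ¬ IsEmptySet S →
      ∃ m : M, m ∈ S ∧ ∀ x : M, x ∈ S → x ≠ m → Related R m x

/-- `n` is the von Neumann numeral of the natural number `k`. -/
def IsNumeral : ℕ → M → Prop
  | 0, n => IsEmptySet n
  | k + 1, n => ∃ m : M, IsNumeral k m ∧ IsSucc n m

end Internal

/-- Hindman's theorem `HT`, as a statement about the structure `M`: for every infinite set `X` and
every colouring `c : [X]^{<ω} → 2` there is an infinite, pairwise disjoint `Y ⊆ [X]^{<ω}` such that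
`FU(Y)` is `c`-monochromatic. (The sets `[X]^{<ω}` and `2` are claimed to exist.) -/
def HindmansTheorem (M : Type*) [ZFAStructure M] : Prop :=
  ∀ X : M, IsSet X → ¬ IsFinite X →
    ∃ P t : M, IsFinPowerset P X ∧ IsTwo t ∧
      ∀ c : M, IsFunction c P t →
        ∃ Y : M, IsSubset Y P ∧ ¬ IsFinite Y ∧ IsPairwiseDisjoint Y ∧ IsMonochromaticFU c t Y

/-! ## The universe of sets over a type of atoms -/

/-- Codes for atoms and for sets: a set is coded by a small family of codes of its members. -/
inductive PreSet (A : Type) : Type (u + 1)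
  | atom (a : A) : PreSet A
  | mk (α : Type u) (f : α → PreSet A) : PreSet A

namespace PreSet

variable {A : Type}

/-- Two codes are equivalent if they code the same atom, or sets with the same members. -/
def Equiv : PreSet.{u} A → PreSet.{u} A → Prop
  | atom a, atom b => a = b
  | mk _ f, mk _ g => (∀ i, ∃ j, Equiv (f i) (g j)) ∧ ∀ j, ∃ i, Equiv (f i) (g j)
  | atom _, mk _ _ => False
  | mk _ _, atom _ => False

theorem Equiv.refl (x : PreSet.{u} A) : Equiv x x := by
  induction x with
  | atom a => simp [Equiv]
  | mk α f ih => exact ⟨fun i => ⟨i, ih i⟩, fun i => ⟨i, ih i⟩⟩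

theorem Equiv.symm {x y : PreSet.{u} A} (h : Equiv x y) : Equiv y x := by
  induction x generalizing y with
  | atom a =>
    cases y with
    | atom b => exact Eq.symm h
    | mk β g => exact h
  | mk α f ih =>
    cases y with
    | atom b => exact h
    | mk β g =>
      refine ⟨fun j => ?_, fun i => ?_⟩
      · obtain ⟨i, hi⟩ := h.2 j
        exact ⟨i, ih i hi⟩
      · obtain ⟨j, hj⟩ := h.1 i
        exact ⟨j, ih i hj⟩

theorem Equiv.trans {x y z : PreSet.{u} A} (h : Equiv x y) (h' : Equiv y z) : Equiv x z := by
  induction x generalizing y z with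
  | atom a =>
    cases y with
    | atom b =>
      cases z with
      | atom c => exact Eq.trans h h'
      | mk γ k => exact h'
    | mk β g => exact h.elim
  | mk α f ih =>
    cases y with
    | atom b => exact h.elim
    | mk β g =>
      cases z with
      | atom c => exact h'
      | mk γ k =>
        refine ⟨fun i => ?_, fun l => ?_⟩
        · obtain ⟨j, hj⟩ := h.1 i
          obtain ⟨l, hl⟩ := h'.1 j
          exact ⟨l, ih i hj hl⟩
        · obtain ⟨j, hj⟩ := h'.2 l
          obtain ⟨i, hi⟩ := h.2 j
          exact ⟨i, ih i hi hj⟩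

instance setoid (A : Type) : Setoid (PreSet.{u} A) where
  r := Equiv
  iseqv := ⟨Equiv.refl, Equiv.symm, Equiv.trans⟩

/-- `x` codes a member of what `y` codes; atoms have no members. -/
def Mem (x : PreSet.{u} A) : PreSet.{u} A → Prop
  | atom _ => False
  | mk _ f => ∃ i, Equiv x (f i)

/-- The code is that of an atom. -/
def IsAtom : PreSet.{u} A → Prop
  | atom _ => True
  | mk _ _ => False

/-- The action of a permutation of the atoms, `π x = {π y : y ∈ x}` for sets `x`. -/
def act (π : Equiv.Perm A) : PreSet.{u} A → PreSet.{u} A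
  | atom a => atom (π a)
  | mk α f => mk α fun i => act π (f i)

theorem mem_congr {x x' y y' : PreSet.{u} A} (hx : Equiv x x') (hy : Equiv y y') :
    Mem x y = Mem x' y' := by
  cases y with
  | atom b =>
    cases y' with
    | atom b' => rfl
    | mk β' g' => exact hy.elim
  | mk β g =>
    cases y' with
    | atom b' => exact hy.elim
    | mk β' g' =>
      refine propext ⟨?_, ?_⟩
      · rintro ⟨i, hi⟩
        obtain ⟨j, hj⟩ := hy.1 i
        exact ⟨j, (hx.symm.trans hi).trans hj⟩
      · rintro ⟨j, hj⟩
        obtain ⟨i, hi⟩ := hy.2 j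
        exact ⟨i, (hx.trans hj).trans hi.symm⟩

theorem isAtom_congr {x y : PreSet.{u} A} (h : Equiv x y) : IsAtom x = IsAtom y := by
  cases x <;> cases y <;> first | rfl | exact h.elim

theorem act_congr (π : Equiv.Perm A) {x y : PreSet.{u} A} (h : Equiv x y) :
    Equiv (act π x) (act π y) := by
  induction x generalizing y with
  | atom a =>
    cases y with
    | atom b => exact congrArg π h
    | mk β g => exact h
  | mk α f ih =>
    cases y with
    | atom b => exact h
    | mk β g =>
      refine ⟨fun i => ?_, fun j => ?_⟩
      · obtain ⟨j, hj⟩ := h.1 i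
        exact ⟨j, ih i hj⟩
      · obtain ⟨i, hi⟩ := h.2 j
        exact ⟨i, ih i hi⟩

end PreSet

/-- The universe of all sets and atoms over the type `A` of atoms. -/
def Univ (A : Type) : Type (u + 1) := Quotient (PreSet.setoid.{u} A)

namespace Univ

variable {A : Type}

instance : ZFAStructure (Univ.{u} A) where
  mem y x := Quotient.liftOn₂ x y PreSet.Mem fun _ _ _ _ => PreSet.mem_congr
  IsAtom x := Quotient.liftOn x PreSet.IsAtom fun _ _ => PreSet.isAtom_congr

/-- The atom `a`, as an element of the universe. -/
def atom (a : A) : Univ.{u} A := Quotient.mk _ (PreSet.atom a)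

/-- The action of a permutation `π` of the atoms on the universe. -/
def act (π : Equiv.Perm A) : Univ.{u} A → Univ.{u} A :=
  Quotient.map (PreSet.act π) fun _ _ => PreSet.act_congr π

end Univ

/-! ## Permutation models with finite supports -/

section PermutationModel

variable {A : Type} (G : Subgroup (Equiv.Perm A))

/-- `π` belongs to `fix(E)`: it is an element of `G` that fixes every atom in `E`. -/
def FixesPointwise (E : Finset A) (π : Equiv.Perm A) : Prop := π ∈ G ∧ ∀ a ∈ E, π a = a

/-- `E` supports `x`: every element of `G` that fixes `E` pointwise fixes `x`. -/
def Supports (E : Finset A) (x : Univ.{u} A) : Prop :=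
  ∀ π : Equiv.Perm A, FixesPointwise G E π → Univ.act π x = x

/-- `x` is symmetric, with respect to the normal filter on `G` generated by the groups `fix(E)`,
where `E` is a finite set of atoms. -/
def IsSymmetric (x : Univ.{u} A) : Prop := ∃ E : Finset A, Supports G E x

/-- `x` is hereditarily symmetric: it is symmetric, and so are its members, their members, and so
on. -/
inductive IsHereditarilySymmetric : Univ.{u} A → Prop
  | intro (x : Univ.{u} A) (hx : IsSymmetric G x)
      (h : ∀ y : Univ.{u} A, y ∈ x → IsHereditarilySymmetric y) : IsHereditarilySymmetric x

/-- The permutation model given by `G` and finite supports: the hereditarily symmetric elements of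
the universe (atoms included), with the membership relation of the universe. -/
def PermutationModel : Type (u + 1) := {x : Univ.{u} A // IsHereditarilySymmetric G x}

instance : ZFAStructure (PermutationModel.{u} G) where
  mem y x := x.1 ∈ y.1
  IsAtom x := ZFAStructure.IsAtom x.1

end PermutationModel

/-! ## The second Fraenkel model -/

/-- The atoms of the second Fraenkel model: `aₙ = (n, false)` and `bₙ = (n, true)`, for `n : ℕ`. -/
abbrev PairAtom : Type := ℕ × Bool

/-- The pair `Pₙ = {aₙ, bₙ}`. -/
def atomPair (n : ℕ) : Set PairAtom := {(n, false), (n, true)}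

/-- The group of all permutations `π` of the atoms such that `π[Pₙ] = Pₙ` for all `n`. -/
def pairGroup : Subgroup (Equiv.Perm PairAtom) where
  carrier := {π | ∀ n, π '' atomPair n = atomPair n}
  one_mem' := fun n => by simp
  mul_mem' := fun {π σ} hπ hσ n => by
    rw [Equiv.Perm.coe_mul, Set.image_comp, hσ n, hπ n]
  inv_mem' := fun {π} hπ n => by
    have h : (π⁻¹ : Equiv.Perm PairAtom) '' (π '' atomPair n) = atomPair n := by
      rw [← Set.image_comp, ← Equiv.Perm.coe_mul, inv_mul_cancel, Equiv.Perm.coe_one, Set.image_id]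
    rwa [hπ n] at h

/-- The second Fraenkel model `𝒩₂`. -/
abbrev SecondFraenkelModel : Type (u + 1) := PermutationModel.{u} pairGroup

end ZFA

/-! The reason is that orbits are finite. An element of the group preserves each pair `Pₙ`, so on a
finite support of `x` it makes only finitely many choices, and these determine the image of `x`
(`finite_orbit`). Let `E` support an infinite set `X`. The `fix(E)`-orbits partition `X` into finite
pieces, and there must be infinitely many of them (`exists_orbits`). Each orbit is supported by `E`,
even though its members need not be. Hence any enumeration of orbits made in the ambient universe,
with choice, has support `E` and belongs to the model (`exists_sequence`); this gives (2).

For (1), a finite set `s` of indices receives the colour of the union of the orbits `Y k`, `k ∈ s`.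
The finite unions theorem, applied outside the model, yields disjoint blocks of indices. The
corresponding unions of orbits are all supported by `E`, so their family lies in the model, and it
is monochromatic there. The argument relies on finiteness meaning the same inside and outside the
model (`isFinite_iff`). -/

/-! ## The finite unions theorem -/

/-- Finite sets under disjoint union, completed by an absorbing element `none` for undefined
products. -/
def PartialUnion : Type := Option (Finset ℕ)

namespace PartialUnion

/-- A finite set as an element of `PartialUnion`. -/
def of (s : Finset ℕ) : PartialUnion := some s

theorem of_injective : Function.Injective of := Option.some_injective _

/-- Commutativity and the unit give meaning to products over finite index sets, as
`Hindman.FP.finsetProd` requires. -/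
instance : CommMonoid PartialUnion where
  mul x y := x.bind fun s => y.bind fun t => if Disjoint s t then some (s ∪ t) else none
  one := some ∅
  mul_assoc x y z := by
    change Option.bind (Option.bind _ _) _ = Option.bind _ fun _ => Option.bind (Option.bind _ _) _
    rcases x with _ | x <;> rcases y with _ | y <;> rcases z with _ | z <;> simp
    by_cases h₁ : Disjoint x y <;> by_cases h₂ : Disjoint x z <;> by_cases h₃ : Disjoint y z <;>
      simp [h₁, h₂, h₃, Finset.union_assoc]
  one_mul x := by
    change Option.bind (some ∅) _ = _
    rcases x with _ | x <;> simp
  mul_one x := by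
    change Option.bind _ (fun s => Option.bind (some ∅) _) = _
    rcases x with _ | x <;> simp
  mul_comm x y := by
    change Option.bind _ _ = Option.bind _ _
    rcases x with _ | x <;> rcases y with _ | y <;>
      simp [disjoint_comm, Finset.union_comm]

theorem of_mul_of {s t : Finset ℕ} (h : Disjoint s t) : of s * of t = of (s ∪ t) :=
  if_pos h

/-- This recovers disjointness from the semigroup form of Hindman's theorem, which by itself says
nothing about it. -/
theorem disjoint_of_mul_eq {s t r : Finset ℕ} (h : of s * of t = of r) : Disjoint s t := by
  by_contra hn
  exact Option.some_ne_none r (h.symm.trans (if_neg hn))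

theorem prod_of (b : ℕ → Finset ℕ) (hb : Pairwise fun i j => Disjoint (b i) (b j))
    (s : Finset ℕ) : ∏ i ∈ s, of (b i) = of (s.biUnion b) := by
  induction s using Finset.induction_on with
  | empty => rfl
  | insert i s hi ih =>
    have : Disjoint (b i) (s.biUnion b) := by
      rw [Finset.disjoint_biUnion_right]
      exact fun j hj => hb fun h => hi (h ▸ hj)
    rw [Finset.prod_insert hi, ih, of_mul_of this, Finset.biUnion_insert]

/-- Products of distinct singletons never collapse to `none`. The offset `k` varies because the
induction passes to tails; the bound `k ≤ i` on the tail keeps the head `{k}` disjoint from the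
rest. -/
theorem exists_of_of_mem_FP {a : Stream' PartialUnion} {x : PartialUnion}
    (h : x ∈ Hindman.FP a) (k : ℕ)
    (ha : a = fun i => of {k + i}) :
    ∃ s : Finset ℕ, s.Nonempty ∧ (∀ i ∈ s, k ≤ i) ∧ x = of s := by
  have tail {a : Stream' PartialUnion} {k : ℕ}
      (ha : a = fun i => of {k + i}) :
      a.tail = fun i => of {k + 1 + i} := by
    subst ha
    funext i
    change of {k + (i + 1)} = _
    rw [add_right_comm, add_assoc]
  induction h generalizing k with
  | head' a =>
    subst ha
    exact ⟨{k}, by simp, by simp, rfl⟩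
  | tail' a x _ ih =>
    obtain ⟨s, hs, hk, rfl⟩ := ih (k + 1) (tail ha)
    exact ⟨s, hs, fun i hi => (Nat.le_succ k).trans (hk i hi), rfl⟩
  | cons' a x _ ih =>
    obtain ⟨s, hs, hk, rfl⟩ := ih (k + 1) (tail ha)
    have hd : Disjoint {k} s := by
      rw [Finset.disjoint_singleton_left]
      exact fun h => absurd (hk k h) (by omega)
    refine ⟨{k} ∪ s, by simp, ?_, ?_⟩
    · simp only [Finset.mem_union, Finset.mem_singleton]
      rintro i (rfl | hi)
      · exact le_rfl
      · exact (Nat.le_succ k).trans (hk i hi)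
    · subst ha
      change of {k} * of s = _
      exact of_mul_of hd

end PartialUnion

/-- The finite unions theorem: for every 2-colouring of the finite sets of natural numbers there is
a sequence of nonempty, pairwise disjoint sets all of whose finite unions have the same colour. -/
theorem exists_monochromatic_finite_unions (C : Finset ℕ → Prop) :
    ∃ b : ℕ → Finset ℕ, (∀ i, (b i).Nonempty) ∧ (Pairwise fun i j => Disjoint (b i) (b j)) ∧
      ((∀ s : Finset ℕ, s.Nonempty → C (s.biUnion b)) ∨
        ∀ s : Finset ℕ, s.Nonempty → ¬ C (s.biUnion b)) := by
  -- The absorbing element is in no class, so every product formed inside a class is a disjoint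
  -- union.
  let cls (D : Finset ℕ → Prop) : Set PartialUnion :=
    {x | ∃ s : Finset ℕ, s.Nonempty ∧ D s ∧ x = PartialUnion.of s}
  have key (D : Finset ℕ → Prop) (b : Stream' PartialUnion) (h : Hindman.FP b ⊆ cls D) :
      ∃ b : ℕ → Finset ℕ, (∀ i, (b i).Nonempty) ∧ (Pairwise fun i j => Disjoint (b i) (b j)) ∧
        ∀ s : Finset ℕ, s.Nonempty → D (s.biUnion b) := by
    choose c hc hD hbc using fun i => h (Hindman.FP.singleton b i)
    have hdisj : Pairwise fun i j => Disjoint (c i) (c j) := by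
      have aux (i j : ℕ) (hij : i < j) : Disjoint (c i) (c j) := by
        obtain ⟨s, -, -, hs⟩ := h (Hindman.FP.mul_two b i j hij)
        rw [hbc, hbc] at hs
        exact PartialUnion.disjoint_of_mul_eq hs
      intro i j hij
      rcases lt_or_gt_of_ne hij with h | h
      · exact aux i j h
      · exact (aux j i h).symm
    refine ⟨c, hc, hdisj, fun s hs => ?_⟩
    obtain ⟨t, -, ht, hst⟩ := h (Hindman.FP.finsetProd b s hs)
    simp only [hbc] at hst
    rw [PartialUnion.prod_of c hdisj] at hst
    rwa [PartialUnion.of_injective hst]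
  -- The two colour classes cover all finite products of the stream of singletons.
  obtain ⟨S, hS, b, hb⟩ := Hindman.FP_partition_regular
    (fun i => PartialUnion.of {0 + i}) {cls C, cls fun s => ¬ C s} (by simp) (by
      intro x hx
      obtain ⟨s, hs, -, rfl⟩ := PartialUnion.exists_of_of_mem_FP hx 0 rfl
      by_cases h : C s
      · exact ⟨_, Or.inl rfl, s, hs, h, rfl⟩
      · exact ⟨_, Or.inr rfl, s, hs, h, rfl⟩)
  rcases hS with rfl | rfl
  · obtain ⟨c, h₁, h₂, h₃⟩ := key _ b hb
    exact ⟨c, h₁, h₂, Or.inl h₃⟩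
  · obtain ⟨c, h₁, h₂, h₃⟩ := key _ b hb
    exact ⟨c, h₁, h₂, Or.inr h₃⟩

namespace ZFA

/-! ## Sets of atoms and sets -/

namespace Univ

variable {A : Type}

theorem ext {x y : Univ.{u} A} (hx : IsSet x) (hy : IsSet y) (h : ∀ z, z ∈ x ↔ z ∈ y) : x = y := by
  induction x using Quotient.inductionOn with | _ x
  induction y using Quotient.inductionOn with | _ y
  rcases x with a | ⟨α, f⟩
  · exact (hx trivial).elim
  rcases y with b | ⟨β, g⟩
  · exact (hy trivial).elim
  refine Quotient.sound ⟨fun i => ?_, fun j => ?_⟩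
  · exact (h (Quotient.mk _ (f i))).1 ⟨i, PreSet.Equiv.refl _⟩
  · obtain ⟨i, hi⟩ := (h (Quotient.mk _ (g j))).2 ⟨j, PreSet.Equiv.refl _⟩
    exact ⟨i, hi.symm⟩

theorem not_mem_of_not_isSet {x y : Univ.{u} A} (hx : ¬ IsSet x) : ¬ y ∈ x := by
  induction x using Quotient.inductionOn with | _ x
  induction y using Quotient.inductionOn with | _ y
  rcases x with a | ⟨α, f⟩
  · exact fun h => h
  · exact (hx fun h => h).elim

theorem small_members (x : Univ.{u} A) : Small.{u} {y : Univ.{u} A | y ∈ x} := by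
  induction x using Quotient.inductionOn with | _ x
  rcases x with a | ⟨α, f⟩
  · exact @small_subsingleton _ ⟨fun y => (not_mem_of_not_isSet (fun h => h trivial) y.2).elim⟩
  · have : Small.{u} (Set.range fun i => (Quotient.mk (PreSet.setoid A) (f i) : Univ.{u} A)) :=
      small_range _
    refine @small_subset.{u} _ _ _ ?_ this
    intro y hy
    induction y using Quotient.inductionOn with | _ y
    obtain ⟨i, hi⟩ := hy
    exact ⟨i, Quotient.sound hi.symm⟩

/-- A `u`-small collection can be indexed by a type in `Type u`; choosing a code for each element
then gives a code for the whole. -/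
theorem exists_set (S : Set (Univ.{u} A)) [Small.{u} S] :
    ∃ x : Univ.{u} A, IsSet x ∧ ∀ y, y ∈ x ↔ y ∈ S := by
  choose r hr using fun x : Univ.{u} A => Quotient.exists_rep x
  refine ⟨Quotient.mk _ (PreSet.mk (Shrink.{u} S) fun i => r ((equivShrink S).symm i).1),
    fun h => h, fun y => ?_⟩
  induction y using Quotient.inductionOn with | _ y
  constructor
  · rintro ⟨i, hi⟩
    have := Quotient.sound (s := PreSet.setoid A) hi
    exact (this.trans (hr _)) ▸ ((equivShrink S).symm i).2
  · intro h
    refine ⟨equivShrink S ⟨_, h⟩, ?_⟩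
    simp only [Equiv.symm_apply_apply]
    exact Quotient.exact (hr _).symm

theorem isSet_act (π : Equiv.Perm A) (x : Univ.{u} A) : IsSet (act π x) ↔ IsSet x := by
  induction x using Quotient.inductionOn with | _ x
  rcases x with a | ⟨α, f⟩ <;> rfl

theorem mem_act_iff (π : Equiv.Perm A) (x z : Univ.{u} A) :
    z ∈ act π x ↔ ∃ y, y ∈ x ∧ z = act π y := by
  induction x using Quotient.inductionOn with | _ x
  induction z using Quotient.inductionOn with | _ z
  rcases x with a | ⟨α, f⟩
  · refine ⟨fun h => h.elim, ?_⟩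
    rintro ⟨y, hy, -⟩
    exact (not_mem_of_not_isSet (fun h => h trivial) hy).elim
  · constructor
    · rintro ⟨i, hi⟩
      exact ⟨Quotient.mk _ (f i), ⟨i, PreSet.Equiv.refl _⟩, Quotient.sound hi⟩
    · rintro ⟨y, hy, hz⟩
      induction y using Quotient.inductionOn with | _ y
      obtain ⟨i, hi⟩ := hy
      exact ⟨i, (Quotient.exact hz).trans (PreSet.act_congr π hi)⟩

theorem act_mem_act (π : Equiv.Perm A) {x y : Univ.{u} A} (h : y ∈ x) : act π y ∈ act π x :=
  (mem_act_iff π x _).2 ⟨y, h, rfl⟩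

theorem act_one (x : Univ.{u} A) : act 1 x = x := by
  induction x using Quotient.inductionOn with | _ x
  refine congrArg (Quotient.mk _) ?_
  induction x with
  | atom a => rfl
  | mk α f ih => exact congrArg (PreSet.mk α) (funext ih)

theorem act_mul (π σ : Equiv.Perm A) (x : Univ.{u} A) : act (π * σ) x = act π (act σ x) := by
  induction x using Quotient.inductionOn with | _ x
  refine congrArg (Quotient.mk _) ?_
  induction x with
  | atom a => rfl
  | mk α f ih => exact congrArg (PreSet.mk α) (funext ih)

theorem act_inv_act (π : Equiv.Perm A) (x : Univ.{u} A) : act π⁻¹ (act π x) = x := by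
  rw [← act_mul, inv_mul_cancel, act_one]

theorem act_injective (π : Equiv.Perm A) : Function.Injective (act.{u} π) :=
  Function.LeftInverse.injective (act_inv_act π)

/-- A permutation fixes a set as soon as it and its inverse map the set into itself. -/
theorem act_eq_self {π : Equiv.Perm A} {x : Univ.{u} A} (hx : IsSet x)
    (h : ∀ y, y ∈ x → act π y ∈ x) (h' : ∀ y, y ∈ x → act π⁻¹ y ∈ x) : act π x = x := by
  refine ext ((isSet_act π x).2 hx) hx fun z => ?_
  rw [mem_act_iff]
  constructor
  · rintro ⟨y, hy, rfl⟩
    exact h y hy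
  · intro hz
    refine ⟨act π⁻¹ z, h' z hz, ?_⟩
    rw [← act_mul, mul_inv_cancel, act_one]

end Univ

/-! ## Building sets in a permutation model -/

section PermutationModel

variable {A : Type} {G : Subgroup (Equiv.Perm A)}

theorem FixesPointwise.one (E : Finset A) : FixesPointwise G E 1 := ⟨G.one_mem, fun _ _ => rfl⟩

theorem FixesPointwise.mul {E : Finset A} {π σ : Equiv.Perm A} (hπ : FixesPointwise G E π)
    (hσ : FixesPointwise G E σ) : FixesPointwise G E (π * σ) :=
  ⟨G.mul_mem hπ.1 hσ.1, fun a ha => by rw [Equiv.Perm.mul_apply, hσ.2 a ha, hπ.2 a ha]⟩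

theorem FixesPointwise.inv {E : Finset A} {π : Equiv.Perm A} (hπ : FixesPointwise G E π) :
    FixesPointwise G E π⁻¹ :=
  ⟨G.inv_mem hπ.1, fun a ha => by rw [Equiv.Perm.inv_eq_iff_eq, hπ.2 a ha]⟩

theorem Supports.mono {E E' : Finset A} {x : Univ.{u} A} (h : Supports G E x) (hE : E ⊆ E') :
    Supports G E' x :=
  fun π hπ => h π ⟨hπ.1, fun a ha => hπ.2 a (hE ha)⟩

theorem IsHereditarilySymmetric.isSymmetric {x : Univ.{u} A} (h : IsHereditarilySymmetric G x) :
    IsSymmetric G x := by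
  cases h with | intro _ hx _ => exact hx

theorem IsHereditarilySymmetric.of_mem {x y : Univ.{u} A} (h : IsHereditarilySymmetric G x)
    (hy : y ∈ x) : IsHereditarilySymmetric G y := by
  cases h with | intro _ _ h => exact h y hy

/-- A finite union of finite supports is again finite. For infinite families a common support has to
come from elsewhere. -/
theorem exists_common_support {S : Set (PermutationModel.{u} G)} (hS : S.Finite) :
    ∃ E : Finset A, ∀ x ∈ S, Supports G E x.1 := by
  classical
  choose e he using fun x : PermutationModel.{u} G => x.2.isSymmetric
  exact ⟨hS.toFinset.biUnion e, fun x hx => (he x).mono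
    (Finset.subset_biUnion_of_mem e (hS.mem_toFinset.2 hx))⟩

namespace PermutationModel

/-- The model is transitive, so extensionality is inherited from the universe. -/
theorem ext {x y : PermutationModel.{u} G} (hx : IsSet x) (hy : IsSet y)
    (h : ∀ z : PermutationModel.{u} G, z ∈ x ↔ z ∈ y) : x = y :=
  Subtype.ext <| Univ.ext hx hy fun z =>
    ⟨fun hz => (h ⟨z, x.2.of_mem hz⟩).1 hz, fun hz => (h ⟨z, y.2.of_mem hz⟩).2 hz⟩

/-- A set of the model mapped into itself by `fix(E)` is an element of the model. -/
theorem exists_set_of_closed (S : Set (PermutationModel.{u} G)) [Small.{u} S] (E : Finset A)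
    (h : ∀ π, FixesPointwise G E π → ∀ x ∈ S, ∃ y ∈ S, y.1 = Univ.act π x.1) :
    ∃ s : PermutationModel.{u} G, IsSet s ∧ Supports G E s.1 ∧ ∀ x, x ∈ s ↔ x ∈ S := by
  obtain ⟨s, hs, hmem⟩ := Univ.exists_set ((fun x : PermutationModel.{u} G => x.1) '' S)
  have closed (π : Equiv.Perm A) (hπ : FixesPointwise G E π) (y : Univ.{u} A) (hy : y ∈ s) :
      Univ.act π y ∈ s := by
    obtain ⟨x, hx, rfl⟩ := (hmem y).1 hy
    obtain ⟨z, hz, hzx⟩ := h π hπ x hx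
    exact (hmem _).2 ⟨z, hz, hzx⟩
  have hsupp : Supports G E s := fun π hπ =>
    Univ.act_eq_self hs (closed π hπ) (closed π⁻¹ hπ.inv)
  refine ⟨⟨s, .intro s ⟨E, hsupp⟩ fun y hy => ?_⟩, hs, hsupp, fun x => ?_⟩
  · obtain ⟨x, -, rfl⟩ := (hmem y).1 hy
    exact x.2
  · refine (hmem x.1).trans ⟨?_, fun hx => ⟨x, hx, rfl⟩⟩
    rintro ⟨y, hy, hyx⟩
    rwa [← Subtype.ext hyx]

theorem exists_set_of_supports (S : Set (PermutationModel.{u} G)) [Small.{u} S] (E : Finset A)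
    (h : ∀ x ∈ S, Supports G E x.1) :
    ∃ s : PermutationModel.{u} G, IsSet s ∧ Supports G E s.1 ∧ ∀ x, x ∈ s ↔ x ∈ S :=
  exists_set_of_closed S E fun π hπ x hx => ⟨x, hx, (h x hx π hπ).symm⟩

theorem exists_set_of_finite {S : Set (PermutationModel.{u} G)} (hS : S.Finite) :
    ∃ s : PermutationModel.{u} G, IsSet s ∧ ∀ x, x ∈ s ↔ x ∈ S := by
  have := hS.countable.to_subtype
  obtain ⟨E, hE⟩ := exists_common_support hS
  obtain ⟨s, hs, -, h⟩ := exists_set_of_supports S E hE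
  exact ⟨s, hs, h⟩

/-- A set whose members are all supported by `E` is supported by `E`. -/
theorem supports_of_members {E : Finset A} {s : PermutationModel.{u} G} (hs : IsSet s)
    (h : ∀ x : PermutationModel.{u} G, x ∈ s → Supports G E x.1) : Supports G E s.1 := by
  have closed (π : Equiv.Perm A) (hπ : FixesPointwise G E π) (y : Univ.{u} A) (hy : y ∈ s.1) :
      Univ.act π y ∈ s.1 := by
    rwa [h ⟨y, s.2.of_mem hy⟩ hy π hπ]
  exact fun π hπ => Univ.act_eq_self hs (closed π hπ) (closed π⁻¹ hπ.inv)

theorem small_members (x : PermutationModel.{u} G) :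
    Small.{u} {y : PermutationModel.{u} G | y ∈ x} := by
  have := Univ.small_members x.1
  exact small_of_injective
    (f := fun y : {y : PermutationModel.{u} G | y ∈ x} =>
      (⟨y.1.1, y.2⟩ : {y : Univ.{u} A | y ∈ x.1}))
    fun y z h => Subtype.ext (Subtype.ext (Subtype.mk.inj h))

/-- A subset is determined by its trace on the small type of members of `x`. -/
theorem small_subsets (x : PermutationModel.{u} G) :
    Small.{u} {y : PermutationModel.{u} G | IsSubset y x} := by
  have := small_members x
  refine small_of_injective
    (f := fun y : {y : PermutationModel.{u} G | IsSubset y x} =>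
      ({z | z.1 ∈ y.1} : Set {z : PermutationModel.{u} G | z ∈ x}))
    fun y z h => Subtype.ext (ext y.2.1 z.2.1 fun a => ⟨fun ha => ?_, fun ha => ?_⟩)
  · exact (Set.ext_iff.1 h ⟨a, y.2.2 a ha⟩).1 ha
  · exact (Set.ext_iff.1 h ⟨a, z.2.2 a ha⟩).2 ha

/-! ### Pairs -/

theorem exists_pairSet (x y : PermutationModel.{u} G) :
    ∃ z : PermutationModel.{u} G, IsPairSet z x y := by
  obtain ⟨z, hz, h⟩ := exists_set_of_finite (Set.toFinite {x, y})
  exact ⟨z, hz, h⟩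

/-- The unordered pair `{x, y}` of the model. -/
noncomputable def pairSet (x y : PermutationModel.{u} G) : PermutationModel.{u} G :=
  (exists_pairSet x y).choose

theorem isPairSet_pairSet (x y : PermutationModel.{u} G) : IsPairSet (pairSet x y) x y :=
  (exists_pairSet x y).choose_spec

theorem isPairSet_iff {x y z : PermutationModel.{u} G} : IsPairSet z x y ↔ z = pairSet x y := by
  refine ⟨fun h => ?_, fun h => h ▸ isPairSet_pairSet x y⟩
  exact ext h.1 (isPairSet_pairSet x y).1 fun w => (h.2 w).trans ((isPairSet_pairSet x y).2 w).symm

theorem mem_pairSet {x y w : PermutationModel.{u} G} : w ∈ pairSet x y ↔ w = x ∨ w = y :=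
  (isPairSet_pairSet x y).2 w

theorem supports_pairSet {E : Finset A} {x y : PermutationModel.{u} G} (hx : Supports G E x.1)
    (hy : Supports G E y.1) : Supports G E (pairSet x y).1 := by
  refine supports_of_members (isPairSet_pairSet x y).1 fun w hw => ?_
  rcases mem_pairSet.1 hw with rfl | rfl
  · exact hx
  · exact hy

/-- The ordered pair `⟨x, y⟩` of the model. -/
noncomputable def ordPair (x y : PermutationModel.{u} G) : PermutationModel.{u} G :=
  pairSet (pairSet x x) (pairSet x y)

theorem isOrdPair_iff {p x y : PermutationModel.{u} G} : IsOrdPair p x y ↔ p = ordPair x y := by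
  simp [IsOrdPair, isPairSet_iff, ordPair]

theorem supports_ordPair {E : Finset A} {x y : PermutationModel.{u} G} (hx : Supports G E x.1)
    (hy : Supports G E y.1) : Supports G E (ordPair x y).1 :=
  supports_pairSet (supports_pairSet hx hx) (supports_pairSet hx hy)

theorem pairSet_inj_right {x y z : PermutationModel.{u} G} (h : pairSet x y = pairSet x z) :
    y = z := by
  have hy : y ∈ pairSet x z := h ▸ mem_pairSet.2 (Or.inr rfl)
  have hz : z ∈ pairSet x y := h ▸ mem_pairSet.2 (Or.inr rfl)
  rcases mem_pairSet.1 hy with rfl | rfl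
  · rcases mem_pairSet.1 hz with rfl | rfl <;> rfl
  · rfl

theorem ordPair_inj {x y x' y' : PermutationModel.{u} G} (h : ordPair x y = ordPair x' y') :
    x = x' ∧ y = y' := by
  have h₁ : pairSet x x ∈ ordPair x' y' := h ▸ mem_pairSet.2 (Or.inl rfl)
  have hx : x = x' := by
    have hx' : x' ∈ pairSet x x := by
      rcases mem_pairSet.1 h₁ with h₂ | h₂ <;> rw [h₂] <;> exact mem_pairSet.2 (Or.inl rfl)
    rcases mem_pairSet.1 hx' with rfl | rfl <;> rfl
  subst hx
  exact ⟨rfl, pairSet_inj_right (pairSet_inj_right h)⟩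

theorem related_iff {f x y : PermutationModel.{u} G} : Related f x y ↔ ordPair x y ∈ f := by
  simp [Related, isOrdPair_iff]

/-! ### Numerals and finite sets -/

theorem isEmptySet_unique {x y : PermutationModel.{u} G} (hx : IsEmptySet x) (hy : IsEmptySet y) :
    x = y :=
  ext hx.1 hy.1 fun z => iff_of_false (hx.2 z) (hy.2 z)

theorem isSucc_unique {n s t : PermutationModel.{u} G} (hs : IsSucc s n) (ht : IsSucc t n) :
    s = t :=
  ext hs.1 ht.1 fun z => (hs.2 z).trans (ht.2 z).symm

variable (G) in
theorem exists_emptySet : ∃ e : PermutationModel.{u} G, IsEmptySet e := by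
  obtain ⟨e, he, h⟩ := exists_set_of_finite (Set.finite_empty (α := PermutationModel.{u} G))
  exact ⟨e, he, fun z hz => (h z).1 hz⟩

/-- The members of `x`, as elements of the model. -/
def members (x : PermutationModel.{u} G) : Set (PermutationModel.{u} G) := {y | y ∈ x}

theorem exists_succ {n : PermutationModel.{u} G} (hn : n.members.Finite) :
    ∃ s : PermutationModel.{u} G, IsSucc s n := by
  obtain ⟨s, hs, h⟩ := exists_set_of_finite (hn.insert n)
  exact ⟨s, hs, fun z => (h z).trans Or.comm⟩

variable (G) in
theorem exists_numeral (k : ℕ) :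
    ∃ n : PermutationModel.{u} G, IsNumeral k n ∧ n.members.Finite := by
  induction k with
  | zero =>
    obtain ⟨e, he⟩ := exists_emptySet G
    exact ⟨e, he, Set.finite_empty.subset fun z hz => he.2 z hz⟩
  | succ k ih =>
    obtain ⟨n, hn, hfin⟩ := ih
    obtain ⟨s, hs⟩ := exists_succ hfin
    exact ⟨s, ⟨n, hn, hs⟩, (hfin.insert n).subset fun z hz => ((hs.2 z).1 hz).symm⟩

theorem isNumeral_unique {k : ℕ} {m n : PermutationModel.{u} G} (hm : IsNumeral k m)
    (hn : IsNumeral k n) : m = n := by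
  induction k generalizing m n with
  | zero => exact isEmptySet_unique hm hn
  | succ k ih =>
    obtain ⟨m', hm', hm⟩ := hm
    obtain ⟨n', hn', hn⟩ := hn
    obtain rfl := ih hm' hn'
    exact isSucc_unique hm hn

variable (G) in
/-- The von Neumann numeral of `k` in the model. -/
noncomputable def numeral (k : ℕ) : PermutationModel.{u} G := (exists_numeral G k).choose

theorem isNumeral_numeral (k : ℕ) : IsNumeral k (numeral.{u} G k) :=
  (exists_numeral G k).choose_spec.1

theorem isEmptySet_numeral_zero : IsEmptySet (numeral.{u} G 0) := isNumeral_numeral 0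

theorem isSucc_numeral (k : ℕ) : IsSucc (numeral.{u} G (k + 1)) (numeral G k) := by
  obtain ⟨m, hm, hs⟩ := isNumeral_numeral.{u} (G := G) (k + 1)
  rwa [isNumeral_unique (isNumeral_numeral k) hm]

theorem isSet_numeral (k : ℕ) : IsSet (numeral.{u} G k) := by
  cases k with
  | zero => exact isEmptySet_numeral_zero.1
  | succ k => exact (isSucc_numeral k).1

theorem mem_numeral {k : ℕ} {x : PermutationModel.{u} G} :
    x ∈ numeral G k ↔ ∃ j < k, x = numeral G j := by
  induction k with
  | zero => exact iff_of_false (isEmptySet_numeral_zero.2 x) (by simp)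
  | succ k ih =>
    rw [(isSucc_numeral k).2 x, ih]
    constructor
    · rintro (⟨j, hj, rfl⟩ | rfl)
      · exact ⟨j, hj.trans k.lt_succ_self, rfl⟩
      · exact ⟨k, k.lt_succ_self, rfl⟩
    · rintro ⟨j, hj, rfl⟩
      rcases (Nat.lt_succ_iff.1 hj).lt_or_eq with h | rfl
      · exact Or.inl ⟨j, h, rfl⟩
      · exact Or.inr rfl

/-- If `k + 1` were in itself, it would be `k` or an earlier numeral; since `k ∈ k + 1`, this would
put `k` in `k`. -/
theorem numeral_not_mem_self (k : ℕ) : ¬ numeral.{u} G k ∈ numeral G k := by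
  induction k with
  | zero => exact isEmptySet_numeral_zero.2 _
  | succ k ih =>
    intro h
    have hk : numeral.{u} G k ∈ numeral G (k + 1) := mem_numeral.2 ⟨k, k.lt_succ_self, rfl⟩
    rcases ((isSucc_numeral k).2 _).1 h with h' | h'
    · obtain ⟨j, hj, hjk⟩ := mem_numeral.1 h'
      refine ih ?_
      rw [hjk] at hk
      obtain ⟨i, hi, hik⟩ := mem_numeral.1 hk
      exact mem_numeral.2 ⟨i, hi.trans hj, hik⟩
    · rw [h'] at hk
      exact ih hk

theorem numeral_injective : Function.Injective (numeral.{u} G) := by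
  have aux (i j : ℕ) (h : i < j) : numeral.{u} G i ≠ numeral G j := fun he =>
    numeral_not_mem_self (G := G) j (mem_numeral.2 ⟨i, h, he.symm⟩)
  intro i j h
  by_contra hne
  rcases lt_or_gt_of_ne hne with hlt | hlt
  · exact aux i j hlt h
  · exact aux j i hlt h.symm

theorem supports_numeral (E : Finset A) (k : ℕ) : Supports G E (numeral.{u} G k).1 := by
  induction k using Nat.strong_induction_on with
  | _ k ih =>
    refine supports_of_members (isSet_numeral k) fun x hx => ?_
    obtain ⟨j, hj, rfl⟩ := mem_numeral.1 hx
    exact ih j hj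

theorem mem_of_isInductive {I : PermutationModel.{u} G} (hI : IsInductive I) (k : ℕ) :
    numeral G k ∈ I := by
  induction k with
  | zero =>
    obtain ⟨e, he, heI⟩ := hI.2.1
    rwa [isEmptySet_unique isEmptySet_numeral_zero he]
  | succ k ih =>
    obtain ⟨s, hs, hsI⟩ := hI.2.2 _ ih
    rwa [isSucc_unique (isSucc_numeral k) hs]

-- Numerals have empty support, so the true natural numbers form a set of the model, and this set is
-- its `ω`.
variable (G) in
theorem exists_omega : ∃ w : PermutationModel.{u} G,
    IsOmega w ∧ ∀ x, x ∈ w ↔ ∃ k, x = numeral G k := by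
  obtain ⟨w, hw, -, h⟩ := exists_set_of_supports (G := G) (Set.range (numeral.{u} G)) ∅ (by
    rintro _ ⟨k, rfl⟩
    exact supports_numeral ∅ k)
  refine ⟨w, ⟨⟨hw, ⟨_, isEmptySet_numeral_zero, (h _).2 ⟨0, rfl⟩⟩, fun n hn => ?_⟩,
    fun I hI => ⟨hw, fun z hz => ?_⟩⟩, fun x => (h x).trans ⟨?_, ?_⟩⟩
  · obtain ⟨k, rfl⟩ := (h n).1 hn
    exact ⟨_, isSucc_numeral k, (h _).2 ⟨k + 1, rfl⟩⟩
  · obtain ⟨k, rfl⟩ := (h z).1 hz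
    exact mem_of_isInductive hI k
  · rintro ⟨k, rfl⟩
    exact ⟨k, rfl⟩
  · rintro ⟨k, rfl⟩
    exact ⟨k, rfl⟩

theorem isTwo_numeral : IsTwo (numeral.{u} G 2) :=
  ⟨_, _, isEmptySet_numeral_zero, isSucc_numeral 0, isSet_numeral 2, fun x => by
    rw [(isSucc_numeral 1).2, (isSucc_numeral 0).2]
    simp [isEmptySet_numeral_zero.2 x]⟩

/-- A function of the model, given by its graph. -/
theorem exists_function {X Y : PermutationModel.{u} G}
    {E : Finset A} {g : PermutationModel.{u} G → PermutationModel.{u} G}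
    (hX : ∀ x, x ∈ X → g x ∈ Y) (hE : ∀ x, x ∈ X → Supports G E x.1 ∧ Supports G E (g x).1) :
    ∃ f : PermutationModel.{u} G, IsFunction f X Y ∧
      ∀ x y, Related f x y ↔ x ∈ X ∧ y = g x := by
  have := small_members X
  obtain ⟨f, hf, -, h⟩ := exists_set_of_supports
    ((fun x => ordPair x (g x)) '' {x : PermutationModel.{u} G | x ∈ X}) E (by
      rintro _ ⟨x, hx, rfl⟩
      exact supports_ordPair (hE x hx).1 (hE x hx).2)
  have hrel (x y : PermutationModel.{u} G) : Related f x y ↔ x ∈ X ∧ y = g x := by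
    rw [related_iff, h]
    constructor
    · rintro ⟨x', hx', hp⟩
      obtain ⟨rfl, rfl⟩ := ordPair_inj hp
      exact ⟨hx', rfl⟩
    · rintro ⟨hx, rfl⟩
      exact ⟨x, hx, rfl⟩
  refine ⟨f, ⟨hf, fun p hp => ?_, fun x hx => ?_⟩, hrel⟩
  · obtain ⟨x, hx, rfl⟩ := (h p).1 hp
    exact ⟨x, g x, hx, hX x hx, isOrdPair_iff.2 rfl⟩
  · exact ⟨g x, (hrel x _).2 ⟨hx, rfl⟩, fun y hy => ((hrel x y).1 hy).2⟩

theorem finite_members_numeral (k : ℕ) : (numeral.{u} G k).members.Finite :=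
  ((Set.finite_Iio k).image (numeral G)).subset fun x hx => by
    obtain ⟨j, hj, rfl⟩ := mem_numeral.1 hx
    exact ⟨j, hj, rfl⟩

/-- A set is finite in the model if and only if it has finitely many members. -/
theorem isFinite_iff (X : PermutationModel.{u} G) : IsFinite X ↔ X.members.Finite := by
  classical
  constructor
  · rintro ⟨w, n, f, hw, hn, hf⟩
    obtain ⟨ω, hω, hmem⟩ := exists_omega.{u} G
    -- Minimality of `w` places it inside the set of true numerals, so `n` has only finitely many
    -- members.
    obtain ⟨k, rfl⟩ := (hmem n).1 ((hw.2 ω hω.1).2 n hn)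
    choose g hg using fun y : X.members => hf.2 y.1 y.2
    have : Finite (numeral.{u} G k).members := (finite_members_numeral k).to_subtype
    refine Set.finite_coe_iff.1 (Finite.of_injective
      (fun y => (⟨g y, (hg y).1⟩ : (numeral.{u} G k).members)) fun y z h => ?_)
    have hgy := (hg y).2
    rw [Subtype.mk.inj h] at hgy
    exact Subtype.ext ((hf.1.1.2.2 _ (hg z).1).unique hgy (hg z).2)
  · intro hX
    obtain ⟨w, hw, hmem⟩ := exists_omega.{u} G
    have := hX.fintype
    let e := Fintype.equivFin X.members
    -- An external enumeration of `X` lies in the model because its finitely many values share a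
    -- support.
    obtain ⟨E, hE⟩ := exists_common_support hX
    -- The value off the numerals below the cardinality is irrelevant.
    let g : PermutationModel.{u} G → PermutationModel.{u} G := fun x =>
      if h : ∃ i : Fin (Fintype.card X.members), x = numeral G i then (e.symm h.choose).1 else x
    have hg (i : Fin (Fintype.card X.members)) : g (numeral G i) = (e.symm i).1 := by
      have h : ∃ j : Fin (Fintype.card X.members), numeral.{u} G i = numeral G j := ⟨i, rfl⟩
      simp only [g, dif_pos h]
      rw [← Fin.ext (numeral_injective h.choose_spec)]
    obtain ⟨f, hf, hrel⟩ := exists_function (G := G) (X := numeral G (Fintype.card X.members))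
      (Y := X) (E := E) (g := g) (fun x hx => by
        obtain ⟨j, hj, rfl⟩ := mem_numeral.1 hx
        rw [hg ⟨j, hj⟩]
        exact (e.symm _).2) (fun x hx => by
        obtain ⟨j, hj, rfl⟩ := mem_numeral.1 hx
        rw [hg ⟨j, hj⟩]
        exact ⟨supports_numeral E j, hE _ (e.symm _).2⟩)
    refine ⟨w, _, f, hw, (hmem _).2 ⟨Fintype.card X.members, rfl⟩, ⟨hf, fun x x' y hx hx' => ?_⟩,
      fun y hy => ⟨numeral G (e ⟨y, hy⟩), mem_numeral.2 ⟨_, (e ⟨y, hy⟩).2, rfl⟩, ?_⟩⟩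
    · obtain ⟨h, rfl⟩ := (hrel _ _).1 hx
      obtain ⟨h', he⟩ := (hrel _ _).1 hx'
      obtain ⟨i, hi, rfl⟩ := mem_numeral.1 h
      obtain ⟨j, hj, rfl⟩ := mem_numeral.1 h'
      rw [hg ⟨i, hi⟩, hg ⟨j, hj⟩] at he
      have := e.symm.injective (Subtype.ext he)
      rw [Fin.mk.inj this]
    · refine (hrel _ _).2 ⟨mem_numeral.2 ⟨_, (e ⟨y, hy⟩).2, rfl⟩, ?_⟩
      rw [hg, e.symm_apply_apply]

/-- The set of all finite subsets of a set of the model. -/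
theorem exists_finPowerset (X : PermutationModel.{u} G) :
    ∃ P : PermutationModel.{u} G, IsFinPowerset P X := by
  obtain ⟨E, hE⟩ := X.2.isSymmetric
  have := small_subsets X
  have : Small.{u} {y : PermutationModel.{u} G | IsSubset y X ∧ y.members.Finite} :=
    small_sep {y : PermutationModel.{u} G | IsSubset y X} fun y => y.members.Finite
  obtain ⟨P, hP, -, h⟩ := exists_set_of_closed
    {y : PermutationModel.{u} G | IsSubset y X ∧ y.members.Finite} E (by
      rintro π hπ y ⟨hyX, hfin⟩
      have hmem (z : y.members) : Univ.act π z.1.1 ∈ X.1 := by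
        rw [← hE π hπ]
        exact Univ.act_mem_act π (hyX.2 _ z.2)
      have := hfin.to_subtype
      -- The image of `y` under `π` is rebuilt inside the model, as a finite set of members of `X`.
      obtain ⟨s, hs, h⟩ := exists_set_of_finite
        (Set.finite_range fun z : y.members => (⟨_, X.2.of_mem (hmem z)⟩ : PermutationModel.{u} G))
      refine ⟨s, ⟨⟨hs, fun z hz => ?_⟩, (Set.finite_range _).subset fun z hz => (h z).1 hz⟩, ?_⟩
      · obtain ⟨a, rfl⟩ := (h z).1 hz
        exact hmem a
      · refine Univ.ext hs ((Univ.isSet_act π y.1).2 hyX.1) fun z => ?_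
        rw [Univ.mem_act_iff]
        constructor
        · intro hz
          obtain ⟨a, ha⟩ := (h ⟨z, s.2.of_mem hz⟩).1 hz
          exact ⟨a.1.1, a.2, (congrArg Subtype.val ha).symm⟩
        · rintro ⟨a, ha, rfl⟩
          exact (h ⟨_, X.2.of_mem (hmem ⟨⟨a, y.2.of_mem ha⟩, ha⟩)⟩).2
            ⟨⟨⟨a, y.2.of_mem ha⟩, ha⟩, rfl⟩)
  exact ⟨P, hP, fun y => by rw [isFinite_iff]; exact h y⟩

end PermutationModel
end PermutationModel
end ZFA

namespace ZFA

open PermutationModel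

/-! ## Orbits in the second Fraenkel model -/

/-- Elements of the group that agree on a support `E` of `x` have the same effect on `x`. Each keeps
the first coordinate of an atom, so one bit per atom of `E` decides the image: at most `2 ^ |E|`
images occur. -/
theorem finite_orbit (x : SecondFraenkelModel.{u}) :
    {z : Univ.{u} PairAtom | ∃ π ∈ pairGroup, z = Univ.act π x.1}.Finite := by
  obtain ⟨E, hE⟩ := x.2.isSymmetric
  have hagree (π σ : Equiv.Perm PairAtom) (hπ : π ∈ pairGroup) (hσ : σ ∈ pairGroup)
      (h : ∀ a ∈ E, (π a).2 = (σ a).2) : Univ.act π x.1 = Univ.act σ x.1 := by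
    have fst (τ : Equiv.Perm PairAtom) (hτ : τ ∈ pairGroup) (a : PairAtom) : (τ a).1 = a.1 := by
      have ha : a ∈ atomPair a.1 := by
        rcases a with ⟨n, _ | _⟩ <;> simp [atomPair]
      have : τ a ∈ atomPair a.1 := hτ a.1 ▸ Set.mem_image_of_mem τ ha
      rcases this with h | h <;> rw [h]
    have := hE (σ⁻¹ * π) ⟨pairGroup.mul_mem (pairGroup.inv_mem hσ) hπ, fun a ha => by
      rw [Equiv.Perm.mul_apply, Equiv.Perm.inv_eq_iff_eq]
      exact Prod.ext ((fst π hπ a).trans (fst σ hσ a).symm) (h a ha)⟩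
    rw [Univ.act_mul] at this
    exact Univ.act_injective σ⁻¹ (this.trans (Univ.act_inv_act σ _).symm)
  choose! g hgG hg using fun z : {z : Univ.{u} PairAtom | ∃ π ∈ pairGroup, z = Univ.act π x.1} => z.2
  refine Set.finite_coe_iff.1 (Finite.of_injective
    (fun z => fun a : E => ((g z) a.1).2) fun z z' h => Subtype.ext ?_)
  rw [hg z, hg z']
  exact hagree _ _ (hgG z) (hgG z') fun a ha => congrFun h ⟨a, ha⟩

/-- An infinite set `X` of the model with support `E` contains infinitely many finite orbits of
`fix(E)`, each of which is supported by `E`. -/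
theorem exists_orbits {X : SecondFraenkelModel.{u}} (hX : X.members.Infinite)
    {E : Finset PairAtom} (hE : Supports pairGroup E X.1) :
    ∃ x Y : ℕ → SecondFraenkelModel.{u},
      (∀ k, x k ∈ X) ∧
      (∀ k z, z ∈ (Y k).1 ↔ ∃ π, FixesPointwise pairGroup E π ∧ z = Univ.act π (x k).1) ∧
      (∀ k, IsSubset (Y k) X ∧ (Y k).members.Finite ∧ Supports pairGroup E (Y k).1) ∧
      ∀ j k z, z ∈ Y j → z ∈ Y k → j = k := by
  let orb (x : Univ.{u} PairAtom) : Set (Univ.{u} PairAtom) :=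
    {z | ∃ π, FixesPointwise pairGroup E π ∧ z = Univ.act π x}
  have orb_self (x) : x ∈ orb x := ⟨1, .one E, (Univ.act_one x).symm⟩
  have orb_closed {x y} {π : Equiv.Perm PairAtom} (hπ : FixesPointwise pairGroup E π)
      (hy : y ∈ orb x) : Univ.act π y ∈ orb x := by
    obtain ⟨σ, hσ, rfl⟩ := hy
    exact ⟨π * σ, hπ.mul hσ, (Univ.act_mul π σ x).symm⟩
  have orb_subset {x y} (h : y ∈ orb x) : orb y ⊆ orb x := by
    rintro _ ⟨π, hπ, rfl⟩
    exact orb_closed hπ h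
  have orb_eq {x y} (h : y ∈ orb x) : orb y = orb x := by
    refine (orb_subset h).antisymm (orb_subset ?_)
    obtain ⟨σ, hσ, rfl⟩ := h
    exact ⟨σ⁻¹, hσ.inv, (Univ.act_inv_act σ x).symm⟩
  have orb_finite (x : SecondFraenkelModel.{u}) : (orb x.1).Finite :=
    (finite_orbit x).subset fun z ⟨π, hπ, hz⟩ => ⟨π, hπ.1, hz⟩
  have orb_mem {x z} (hx : x ∈ X.1) (hz : z ∈ orb x) : z ∈ X.1 := by
    obtain ⟨π, hπ, rfl⟩ := hz
    rw [← hE π hπ]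
    exact Univ.act_mem_act π hx
  -- Finitely many finite orbits would cover only a finite set.
  have hinf : ((fun x : SecondFraenkelModel.{u} => orb x.1) '' X.members).Infinite := by
    intro hfin
    have hU := hfin.sUnion (by
      rintro _ ⟨x, -, rfl⟩
      exact orb_finite x)
    refine hX ((hU.preimage Subtype.val_injective.injOn).subset fun x hx => ?_)
    exact ⟨orb x.1, ⟨x, hx, rfl⟩, orb_self x.1⟩
  -- The orbits and their representatives are enumerated outside the model.
  let e := hinf.natEmbedding
  choose x hxX hxe using fun k => (e k).2
  have hset (k : ℕ) : ∃ Y : SecondFraenkelModel.{u}, IsSet Y ∧ Supports pairGroup E Y.1 ∧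
      ∀ z, z ∈ Y ↔ z.1 ∈ orb (x k).1 := by
    have hfin : {z : SecondFraenkelModel.{u} | z.1 ∈ orb (x k).1}.Finite :=
      (orb_finite (x k)).preimage Subtype.val_injective.injOn
    have := hfin.countable.to_subtype
    exact exists_set_of_closed {z : SecondFraenkelModel.{u} | z.1 ∈ orb (x k).1} E
      fun π hπ z hz => ⟨⟨_, X.2.of_mem (orb_mem (hxX k) (orb_closed hπ hz))⟩, orb_closed hπ hz, rfl⟩
  choose Y hYset hYE hY using hset
  refine ⟨x, Y, hxX, fun k z => ⟨fun hz => (hY k ⟨z, (Y k).2.of_mem hz⟩).1 hz, fun hz => ?_⟩,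
    fun k => ⟨⟨hYset k, fun z hz => orb_mem (hxX k) ((hY k z).1 hz)⟩, ?_, hYE k⟩,
    fun j k z hj hk => ?_⟩
  · exact (hY k ⟨z, X.2.of_mem (orb_mem (hxX k) hz)⟩).2 hz
  · exact ((orb_finite (x k)).preimage Subtype.val_injective.injOn).subset fun z hz => (hY k z).1 hz
  · refine e.injective (Subtype.ext ?_)
    rw [← hxe, ← hxe]
    exact (orb_eq ((hY j z).1 hj)).symm.trans (orb_eq ((hY k z).1 hk))

/-- A sequence of elements of a set of the model with a common support is a function of the
model. -/
theorem exists_sequence {A : Type} {G : Subgroup (Equiv.Perm A)} {w P : PermutationModel.{u} G}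
    (hw : ∀ x, x ∈ w ↔ ∃ k, x = numeral G k) {E : Finset A} {Y : ℕ → PermutationModel.{u} G}
    (hYP : ∀ k, Y k ∈ P) (hYE : ∀ k, Supports G E (Y k).1) :
    ∃ f : PermutationModel.{u} G, IsFunction f w P ∧
      ∀ k y, Related f (numeral G k) y ↔ y = Y k := by
  -- The default `id` is never evaluated on `w`, whose members are all numerals.
  let g := Function.extend (numeral.{u} G) Y id
  have hg (k : ℕ) : g (numeral G k) = Y k := numeral_injective.extend_apply Y id k
  obtain ⟨f, hf, hrel⟩ := exists_function (X := w) (Y := P) (E := E) (g := g)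
    (fun x hx => by
      obtain ⟨k, rfl⟩ := (hw x).1 hx
      rw [hg]
      exact hYP k)
    (fun x hx => by
      obtain ⟨k, rfl⟩ := (hw x).1 hx
      rw [hg]
      exact ⟨supports_numeral E k, hYE k⟩)
  refine ⟨f, hf, fun k y => ?_⟩
  rw [hrel, hg]
  exact and_iff_right ((hw _).2 ⟨k, rfl⟩)

/-! ### Hindman's theorem in the second Fraenkel model -/

theorem hindmansTheorem_secondFraenkelModel : HindmansTheorem SecondFraenkelModel.{u} := by
  classical
  intro X _ hXinf
  rw [isFinite_iff] at hXinf
  obtain ⟨P, hP⟩ := exists_finPowerset X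
  refine ⟨P, _, hP, isTwo_numeral, fun c hc => ?_⟩
  obtain ⟨E, hE⟩ := X.2.isSymmetric
  obtain ⟨x, Y, hxX, hYmem, hY, hYdisj⟩ := exists_orbits hXinf hE
  have hYne (k : ℕ) : x k ∈ Y k := (hYmem k _).2 ⟨1, .one E, (Univ.act_one _).symm⟩
  have hV (s : Finset ℕ) : ∃ V : SecondFraenkelModel.{u}, IsSet V ∧
      ∀ z, z ∈ V ↔ ∃ k ∈ s, z ∈ Y k := by
    obtain ⟨V, hV, h⟩ := exists_set_of_finite
      (s.finite_toSet.biUnion fun k _ => (hY k).2.1)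
    exact ⟨V, hV, fun z => by rw [h]; simp [members]⟩
  choose V hVset hV using hV
  -- The members of `V s` may be moved by `fix(E)`, but only within their orbits.
  have hVsupp (s : Finset ℕ) : Supports pairGroup E (V s).1 := by
    have closed (π) (hπ : FixesPointwise pairGroup E π) (z) (hz : z ∈ (V s).1) :
        Univ.act π z ∈ (V s).1 := by
      obtain ⟨k, hk, hzk⟩ := (hV s ⟨z, (V s).2.of_mem hz⟩).1 hz
      have hmem : Univ.act π z ∈ (Y k).1 := by
        rw [← (hY k).2.2 π hπ]
        exact Univ.act_mem_act π hzk
      exact (hV s ⟨_, (Y k).2.of_mem hmem⟩).2 ⟨k, hk, hmem⟩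
    exact fun π hπ => Univ.act_eq_self (hVset s) (closed π hπ) (closed π⁻¹ hπ.inv)
  have hVP (s : Finset ℕ) : V s ∈ P := by
    refine (hP.2 _).2 ⟨⟨hVset s, fun z hz => ?_⟩, ?_⟩
    · obtain ⟨k, -, hk⟩ := (hV s z).1 hz
      exact (hY k).1.2 z hk
    · rw [isFinite_iff]
      refine (s.finite_toSet.biUnion fun k _ => (hY k).2.1).subset fun z hz => ?_
      obtain ⟨k, hk, hzk⟩ := (hV s z).1 hz
      exact Set.mem_biUnion hk hzk
  obtain ⟨b, hbne, hbdisj, hb⟩ :=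
    exists_monochromatic_finite_unions fun s => Related c (V s) (numeral pairGroup 0)
  have hcol : ∃ i, i ∈ numeral.{u} pairGroup 2 ∧
      ∀ s : Finset ℕ, s.Nonempty → Related c (V (s.biUnion b)) i := by
    rcases hb with h | h
    · exact ⟨_, mem_numeral.2 ⟨0, by omega, rfl⟩, h⟩
    · refine ⟨_, mem_numeral.2 ⟨1, by omega, rfl⟩, fun s hs => ?_⟩
      -- A set not coloured `0` has some colour in `2`, which can only be `1`.
      obtain ⟨i, hi, -⟩ := hc.2.2 _ (hVP (s.biUnion b))
      obtain ⟨p, hp, hpc⟩ := hi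
      obtain ⟨y, j, -, hj, hpyj⟩ := hc.2.1 p hpc
      obtain ⟨rfl, rfl⟩ := ordPair_inj ((isOrdPair_iff.1 hp).symm.trans (isOrdPair_iff.1 hpyj))
      obtain ⟨m, hm, rfl⟩ := mem_numeral.1 hj
      interval_cases m
      · exact (h s hs ⟨p, hp, hpc⟩).elim
      · exact ⟨p, hp, hpc⟩
  have hVdisj {i j : ℕ} {z} (hi : z ∈ V (b i)) (hj : z ∈ V (b j)) : i = j := by
    obtain ⟨k, hk, hzk⟩ := (hV _ _).1 hi
    obtain ⟨l, hl, hzl⟩ := (hV _ _).1 hj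
    obtain rfl := hYdisj k l z hzk hzl
    by_contra hne
    exact Finset.disjoint_left.1 (hbdisj hne) hk hl
  have hVinj : Function.Injective fun j => V (b j) := fun i j hij => by
    obtain ⟨k, hk⟩ := hbne i
    have hmem : x k ∈ V (b i) := (hV _ _).2 ⟨k, hk, hYne k⟩
    exact hVdisj hmem (by simpa only [← hij] using hmem)
  -- The uniform support `E` brings this externally chosen infinite family into the model.
  obtain ⟨F, hF, -, hFmem⟩ := exists_set_of_supports (Set.range fun j => V (b j)) E (by
    rintro _ ⟨j, rfl⟩
    exact hVsupp _)
  obtain ⟨i, hi, hci⟩ := hcol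
  refine ⟨F, ⟨hF, fun z hz => ?_⟩, ?_, fun y y' hy hy' hne z hz => ?_, i, hi,
    fun S hS hSfin hSne => ?_⟩
  · obtain ⟨j, rfl⟩ := (hFmem z).1 hz
    exact hVP _
  · rw [isFinite_iff]
    intro hfin
    exact Set.infinite_range_of_injective hVinj (hfin.subset fun z hz => (hFmem z).2 hz)
  · obtain ⟨j, rfl⟩ := (hFmem y).1 hy
    obtain ⟨k, rfl⟩ := (hFmem y').1 hy'
    exact hne (congrArg (fun j => V (b j)) (hVdisj hz.1 hz.2))
  · rw [isFinite_iff] at hSfin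
    -- Injectivity makes the index set of `S` finite; the union of `S` is then `V` of the union of
    -- the corresponding blocks, whose colour is known.
    have hsfin : {j | V (b j) ∈ S.members}.Finite := hSfin.preimage hVinj.injOn
    refine ⟨V (hsfin.toFinset.biUnion b), ⟨hVset _, fun z => ?_⟩, hci _ ?_⟩
    · rw [hV]
      constructor
      · rintro ⟨k, hk, hz⟩
        obtain ⟨j, hj, hkj⟩ := Finset.mem_biUnion.1 hk
        exact ⟨_, hsfin.mem_toFinset.1 hj, (hV _ _).2 ⟨k, hkj, hz⟩⟩
      · rintro ⟨y, hy, hz⟩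
        obtain ⟨j, rfl⟩ := (hFmem y).1 (hS.2 y hy)
        obtain ⟨k, hk, hzk⟩ := (hV _ _).1 hz
        exact ⟨k, Finset.mem_biUnion.2 ⟨j, hsfin.mem_toFinset.2 hy, hk⟩, hzk⟩
    · by_contra hempty
      rw [Finset.not_nonempty_iff_eq_empty] at hempty
      refine hSne ⟨hS.1, fun y hy => ?_⟩
      obtain ⟨j, rfl⟩ := (hFmem y).1 (hS.2 y hy)
      have : j ∈ hsfin.toFinset := hsfin.mem_toFinset.2 hy
      simp [hempty] at this

end ZFA

/-! ### The main theorem -/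

theorem mainTheorem8 :
    ZFA.HindmansTheorem ZFA.SecondFraenkelModel.{u} ∧
    ∀ X : ZFA.SecondFraenkelModel.{u},
      ZFA.IsSet X → ¬ ZFA.IsFinite X → ¬ ZFA.IsWellOrderable X →
      ∀ E : Finset ZFA.PairAtom, ZFA.Supports ZFA.pairGroup E X.1 →
        ∃ x : ℕ → ZFA.SecondFraenkelModel.{u}, (∀ k, x k ∈ X) ∧
          ∃ w P f : ZFA.SecondFraenkelModel.{u},
            ZFA.IsOmega w ∧ ZFA.IsFinPowerset P X ∧ ZFA.IsInjection f w P ∧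
            ∀ k : ℕ, ∃ n y : ZFA.SecondFraenkelModel.{u},
              ZFA.IsNumeral k n ∧ ZFA.Related f n y ∧
              ∀ z : ZFA.Univ.{u} ZFA.PairAtom,
                z ∈ y.1 ↔ ∃ π : Equiv.Perm ZFA.PairAtom,
                  ZFA.FixesPointwise ZFA.pairGroup E π ∧ z = ZFA.Univ.act π (x k).1 := by
  refine ⟨ZFA.hindmansTheorem_secondFraenkelModel, fun X _ hXinf _ E hE => ?_⟩
  rw [ZFA.PermutationModel.isFinite_iff] at hXinf
  obtain ⟨x, Y, hxX, hYmem, hY, hYdisj⟩ := ZFA.exists_orbits hXinf hE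
  obtain ⟨P, hP⟩ := ZFA.PermutationModel.exists_finPowerset X
  obtain ⟨w, hw, hwmem⟩ := ZFA.PermutationModel.exists_omega.{u} ZFA.pairGroup
  obtain ⟨f, hf, hrel⟩ := ZFA.exists_sequence hwmem (Y := Y)
    (fun k => (hP.2 _).2 ⟨(hY k).1, (ZFA.PermutationModel.isFinite_iff _).2 (hY k).2.1⟩)
    (fun k => (hY k).2.2)
  have hdom {n y : ZFA.SecondFraenkelModel.{u}} (h : ZFA.Related f n y) :
      ∃ k, n = ZFA.PermutationModel.numeral _ k := by
    obtain ⟨p, hp, hpf⟩ := h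
    obtain ⟨n', y', hn', -, hp'⟩ := hf.2.1 p hpf
    rw [ZFA.PermutationModel.isOrdPair_iff] at hp hp'
    rw [(ZFA.PermutationModel.ordPair_inj (hp.symm.trans hp')).1]
    exact (hwmem n').1 hn'
  refine ⟨x, hxX, w, P, f, hw, hP, ⟨hf, fun n n' y hn hn' => ?_⟩, fun k =>
    ⟨_, Y k, ZFA.PermutationModel.isNumeral_numeral k, (hrel k _).2 rfl, hYmem k⟩⟩
  obtain ⟨j, rfl⟩ := hdom hn
  obtain ⟨k, rfl⟩ := hdom hn'
  have hjk : Y j = Y k := ((hrel j y).1 hn).symm.trans ((hrel k y).1 hn')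
  -- Orbits are nonempty and those of distinct indices are disjoint, so equal orbits have equal
  -- indices.
  have hx : x j ∈ Y j := (hYmem j _).2 ⟨1, .one E, (ZFA.Univ.act_one _).symm⟩
  rw [hYdisj j k (x j) hx (hjk ▸ hx)]
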